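/- Let $G$ be a locally compact (Hausdorff) unimodular group and let $\nu$ be a (simultaneously left and right invariant) Haar measure on $G$. Then for every neighbourhood $U$ of the identity of $G$ and every compact set $B \subseteq G$ there exist a compact set $C \supseteq B$ and a partition $\mathcal P$ of $C$ into finitely many pairwise disjoint nonempty Borel sets such that every $P \in \mathcal P$ is contained in a left translate $gU$ for some $g \in G$, and all sets $P \in \mathcal P$ have the same measure $\nu(P)$. -/

import Mathlib

open MeasureTheory MeasureTheory.Measure Topology Pointwise

/-- A finite partition `P` of a subset `C` of a group is `U`-fine if every set of the partition is
contained in some left translate `g U`. (`Finpartition C` is Mathlib's notion of a partition of `C`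
into finitely many pairwise disjoint nonempty sets with union `C`.) -/
def IsUFine {G : Type*} [Group G] (U : Set G) {C : Set G} (P : Finpartition C) : Prop :=
  ∀ p ∈ P.parts, ∃ g : G, p ⊆ g • U

/-- A finite partition is equisize with respect to `ν` if it consists of measurable sets and all
these sets have the same measure. -/
def IsEquisize {G : Type*} [MeasurableSpace G] (ν : Measure G) {C : Set G}
    (P : Finpartition C) : Prop :=
  (∀ p ∈ P.parts, MeasurableSet p) ∧ ∀ p ∈ P.parts, ∀ q ∈ P.parts, ν p = ν q

/-!
If `G` is discrete, `B` itself is partitioned into singletons. Otherwise Haar measure has no atoms: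
disjoint translates show that neighbourhoods of `1` have arbitrarily small measure, which gives
Sierpiński's theorem (`exists_subset_haar_eq`): a measurable set inside a compact set has measurable
subsets of every smaller measure. This argument needs no regularity of `ν`.

Let `V` be a compact symmetric neighbourhood of `1` with `V * V * V ⊆ U`, and `W` a smaller one with
`W * W⁻¹ ⊆ V`. Inside the compact set `V ^ n`, grow a finite set `X` from `1`, adding points of
`X * V * V` whose translates `x • W`, the cores, stay disjoint (`IsCoreTree`). A maximal such `X`
satisfies `V ^ n ⊆ X * V` (`IsCoreTree.exists_pow_subset_mul`). The compact set `K = X * V` is then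
cut into pieces of measure `ε = ν K / N`, where `N` is so large that `ε ≤ ν W`
(`IsCoreTree.isTiled`). The points of `X` are treated in reverse order: near the current point as
many pieces as possible are cut off, and the remainder, of measure less than `ε`, is taken inside
the core of that point, so it is still close to the parent of the point, where it is treated later.
Since remainders always come from the core of a child, they never travel more than one step.
At the root nothing is left over, because `ν K` is a multiple of `ε`.

A general compact set `B` meets finitely many left cosets of the open subgroup generated by `V`.
For `n` large, `B` is covered by left translates of `K`, one in each of these cosets, and left
invariance carries the partition of `K` to each of them with the same `ε`.
-/

/-! ### Intermediate values of measures -/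

/-- A set of finite measure that can be covered by finitely many sets of measure at most `δ`:
any subset of measure at most `r` can be enlarged until its measure is within `δ` of `r`. -/
lemma exists_superset_measure_le_add {α : Type*} [MeasurableSpace α] {μ : Measure α} {A S : Set α}
    {r δ : ENNReal} (hA : MeasurableSet A) (hS : MeasurableSet S) (hSA : S ⊆ A) (hSr : μ S ≤ r)
    (hr : r ≤ μ A) {s : Finset (Set α)} (hs : ∀ p ∈ s, MeasurableSet p ∧ μ p ≤ δ)
    (hcov : A ⊆ ⋃ p ∈ s, p) :
    ∃ S', MeasurableSet S' ∧ S ⊆ S' ∧ S' ⊆ A ∧ μ S' ≤ r ∧ r ≤ μ S' + δ := by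
  classical
  have key : ∃ S', MeasurableSet S' ∧ S ⊆ S' ∧ S' ⊆ A ∧ μ S' ≤ r ∧
      (r ≤ μ S' + δ ∨ ∀ p ∈ s, A ∩ p ⊆ S') := by
    clear hcov
    induction s using Finset.induction_on with
    | empty => exact ⟨S, hS, subset_rfl, hSA, hSr, Or.inr (by simp)⟩
    | insert p s _ ih =>
      obtain ⟨S', h1, h2, h3, h4, h5⟩ := ih fun q hq => hs q (Finset.mem_insert_of_mem hq)
      obtain ⟨hp, hpδ⟩ := hs p (Finset.mem_insert_self _ _)
      rcases h5 with h5 | h5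
      · exact ⟨S', h1, h2, h3, h4, Or.inl h5⟩
      by_cases h : μ (S' ∪ A ∩ p) ≤ r
      · refine ⟨S' ∪ A ∩ p, h1.union (hA.inter hp), h2.trans Set.subset_union_left,
          Set.union_subset h3 Set.inter_subset_left, h, Or.inr fun q hq => ?_⟩
        rcases Finset.mem_insert.1 hq with rfl | hq
        · exact Set.subset_union_right
        · exact (h5 q hq).trans Set.subset_union_left
      · refine ⟨S', h1, h2, h3, h4, Or.inl ?_⟩
        calc r ≤ μ (S' ∪ A ∩ p) := (not_le.1 h).le
          _ ≤ μ S' + μ (A ∩ p) := measure_union_le _ _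
          _ ≤ μ S' + δ := by gcongr; exact (measure_mono Set.inter_subset_right).trans hpδ
  obtain ⟨S', h1, h2, h3, h4, h5⟩ := key
  refine ⟨S', h1, h2, h3, h4, h5.elim id fun h => ?_⟩
  have : A ⊆ S' := fun a ha => by
    obtain ⟨p, hp, hap⟩ := Set.mem_iUnion₂.1 (hcov ha)
    exact h p hp ⟨ha, hap⟩
  exact hr.trans ((measure_mono this).trans le_self_add)

/-- Sierpiński's intermediate value theorem for measures, where non-atomicity is expressed by the
existence of finite covers by sets of arbitrarily small measure. -/
lemma exists_subset_measure_eq_of_small_covers {α : Type*} [MeasurableSpace α] {μ : Measure α}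
    {A : Set α} {r : ENNReal} (hA : MeasurableSet A) (hr : r ≤ μ A)
    (hcov : ∀ δ : ENNReal, δ ≠ 0 → ∃ s : Finset (Set α),
      (∀ p ∈ s, MeasurableSet p ∧ μ p ≤ δ) ∧ A ⊆ ⋃ p ∈ s, p) :
    ∃ S ⊆ A, MeasurableSet S ∧ μ S = r := by
  have step : ∀ (n : ℕ) (S : {S : Set α // MeasurableSet S ∧ S ⊆ A ∧ μ S ≤ r}),
      ∃ S' : {S : Set α // MeasurableSet S ∧ S ⊆ A ∧ μ S ≤ r},
        S.1 ⊆ S'.1 ∧ r ≤ μ S'.1 + (n : ENNReal)⁻¹ := by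
    rintro n ⟨S, h1, h2, h3⟩
    obtain ⟨s, hs, hAs⟩ := hcov (n : ENNReal)⁻¹ (by simp)
    obtain ⟨S', a, b, c, d, e⟩ := exists_superset_measure_le_add hA h1 h2 h3 hr hs hAs
    exact ⟨⟨S', a, c, d⟩, b, e⟩
  choose f hf hfr using step
  let F : ℕ → {S : Set α // MeasurableSet S ∧ S ⊆ A ∧ μ S ≤ r} := fun n =>
    Nat.rec ⟨∅, by simp⟩ f n
  have hmono : Monotone fun n => (F n).1 := monotone_nat_of_le_succ fun n => hf n (F n)
  refine ⟨⋃ n, (F n).1, Set.iUnion_subset fun n => (F n).2.2.1,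
    MeasurableSet.iUnion fun n => (F n).2.1, le_antisymm ?_ ?_⟩
  · rw [hmono.measure_iUnion]
    exact iSup_le fun n => (F n).2.2.2
  · refine ENNReal.le_of_forall_pos_le_add fun δ hδ _ => ?_
    obtain ⟨n, hn⟩ := ENNReal.exists_inv_nat_lt (ENNReal.coe_ne_zero.2 hδ.ne')
    calc r ≤ μ (F (n + 1)).1 + (n : ENNReal)⁻¹ := hfr n (F n)
      _ ≤ _ := by gcongr; exact Set.subset_iUnion (fun n => (F n).1) (n + 1)

/-! ### Division with remainder -/

/-- Division with remainder in the extended nonnegative reals. -/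
lemma ENNReal.exists_eq_nat_mul_add {a ε : ENNReal} (ha : a ≠ ⊤) (hε : ε ≠ 0) :
    ∃ (q : ℕ) (r : ENNReal), r < ε ∧ a = q * ε + r := by
  have h : ∃ n : ℕ, a < n * ε := ENNReal.exists_nat_mul_gt hε ha
  classical
  obtain ⟨q, hq⟩ : ∃ q, Nat.find h = q + 1 := Nat.exists_eq_succ_of_ne_zero fun h0 => by
    have := Nat.find_spec h
    simp [h0] at this
  have h1 : (q : ENNReal) * ε ≤ a := not_lt.1 (Nat.find_min h (by omega))
  have h2 : a < q * ε + ε := by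
    have := Nat.find_spec h
    rwa [hq, Nat.cast_succ, add_mul, one_mul] at this
  have hfin : (q : ENNReal) * ε ≠ ⊤ := ne_top_of_le_ne_top ha h1
  refine ⟨q, a - q * ε, ?_, (add_tsub_cancel_of_le h1).symm⟩
  exact ENNReal.sub_lt_of_lt_add h1 (by rwa [add_comm])

/-! ### Small sets in nondiscrete groups -/

section TopologicalGroup

variable {G : Type*} [Group G] [TopologicalSpace G] [IsTopologicalGroup G]
  [LocallyCompactSpace G] [T2Space G] [MeasurableSpace G] [BorelSpace G]

/-- In a nondiscrete group infinitely many points lie in a compact neighbourhood of `1`, and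
sufficiently small neighbourhoods of finitely many of them are disjoint translates of one set, so
that this set has small measure. No regularity of the Haar measure is needed. -/
lemma exists_nhds_one_measure_le (ν : Measure G) [ν.IsHaarMeasure]
    (hG : ¬ IsOpen ({1} : Set G)) {δ : ENNReal} (hδ : δ ≠ 0) :
    ∃ W ∈ 𝓝 (1 : G), IsOpen W ∧ ν W ≤ δ := by
  obtain ⟨K, hK, hK1⟩ := exists_compact_mem_nhds (1 : G)
  have : (𝓝[≠] (1 : G)).NeBot := ⟨fun h => hG ((isOpen_singleton_iff_punctured_nhds _).2 h)⟩
  have hinf : K.Infinite := infinite_of_mem_nhds 1 hK1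
  have hKK : ν (K * K) ≠ ⊤ := (hK.mul hK).measure_lt_top.ne
  obtain ⟨n, hn⟩ := ENNReal.exists_nat_mul_gt hδ hKK
  obtain ⟨s, hsK, hsn⟩ := hinf.exists_subset_card_eq n
  obtain ⟨O, hO, hOd⟩ := s.finite_toSet.t2_separation
  have hW : IsOpen (interior K ∩ ⋂ x ∈ s, x⁻¹ • O x) :=
    isOpen_interior.inter (isOpen_biInter_finset fun x _ => (hO x).2.smul _)
  refine ⟨interior K ∩ ⋂ x ∈ s, x⁻¹ • O x, hW.mem_nhds ⟨mem_interior_iff_mem_nhds.2 hK1, ?_⟩,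
    hW, ?_⟩
  · simp only [Set.mem_iInter, Set.mem_inv_smul_set_iff, smul_eq_mul, mul_one]
    exact fun x _ => (hO x).1
  set W := interior K ∩ ⋂ x ∈ s, x⁻¹ • O x
  have hsub : ∀ x ∈ s, x • W ⊆ O x := fun x hx => by
    rw [Set.smul_set_subset_iff_subset_inv_smul_set]
    exact Set.inter_subset_right.trans (Set.biInter_subset_of_mem hx)
  have hle : n * ν W ≤ ν (K * K) := by
    calc (n : ENNReal) * ν W = ∑ x ∈ s, ν (x • W) := by simp [measure_smul, hsn]
      _ = ν (⋃ x ∈ s, x • W) := by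
        rw [measure_biUnion_finset (fun x hx y hy hxy => (hOd hx hy hxy).mono (hsub x hx)
          (hsub y hy)) fun x _ => (hW.smul x).measurableSet]
      _ ≤ ν (K * K) := by
        refine measure_mono (Set.iUnion₂_subset fun x hx => ?_)
        rintro _ ⟨w, hw, rfl⟩
        exact Set.mul_mem_mul (hsK hx) (interior_subset hw.1)
  by_contra! h
  exact absurd hn (not_lt.2 (le_trans (by gcongr) hle))

lemma IsCompact.exists_small_cover {ν : Measure G} [ν.IsHaarMeasure]
    (hG : ¬ IsOpen ({1} : Set G)) {A Q : Set G} (hQ : IsCompact Q) (hA : A ⊆ Q)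
    {δ : ENNReal} (hδ : δ ≠ 0) :
    ∃ s : Finset (Set G), (∀ p ∈ s, MeasurableSet p ∧ ν p ≤ δ) ∧ A ⊆ ⋃ p ∈ s, p := by
  classical
  obtain ⟨W, hW1, hWo, hW⟩ := exists_nhds_one_measure_le ν hG hδ
  obtain ⟨t, -, ht⟩ := hQ.elim_nhds_subcover (fun x => x • W)
    fun x _ => by simpa using smul_mem_nhds_smul x hW1
  refine ⟨t.image fun x => x • W, ?_, ?_⟩
  · simp only [Finset.mem_image]
    rintro _ ⟨x, -, rfl⟩
    exact ⟨(hWo.smul x).measurableSet, by rwa [measure_smul]⟩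
  · rw [Finset.set_biUnion_finset_image]
    exact hA.trans ht

/-- Haar measure on a nondiscrete group takes all intermediate values on subsets of compacts. -/
lemma exists_subset_haar_eq {ν : Measure G} [ν.IsHaarMeasure]
    (hG : ¬ IsOpen ({1} : Set G)) {A Q : Set G} (hQ : IsCompact Q) (hAQ : A ⊆ Q)
    (hA : MeasurableSet A) {r : ENNReal} (hr : r ≤ ν A) :
    ∃ S ⊆ A, MeasurableSet S ∧ ν S = r :=
  exists_subset_measure_eq_of_small_covers hA hr
    fun _ hδ => hQ.exists_small_cover hG hAQ hδ

end TopologicalGroup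

/-! ### Tiled sets -/

/-- `IsTiled ν T ε K`: the set `K` is the union of finitely many disjoint measurable sets of
measure `ε`, each contained in a left translate of `T`; the sets are adjoined one at a time. -/
inductive IsTiled {G : Type*} [Group G] [MeasurableSpace G] (ν : Measure G) (T : Set G)
    (ε : ENNReal) : Set G → Prop
  | empty : IsTiled ν T ε ∅
  | union_tile {K p : Set G} (g : G) : IsTiled ν T ε K → MeasurableSet p → ν p = ε → p ⊆ g • T →
      Disjoint K p → IsTiled ν T ε (K ∪ p)

namespace IsTiled

variable {G : Type*} [Group G] [MeasurableSpace G] {ν : Measure G} {T : Set G} {ε : ENNReal}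

lemma union {K L : Set G} (hK : IsTiled ν T ε K) (hL : IsTiled ν T ε L) (h : Disjoint K L) :
    IsTiled ν T ε (K ∪ L) := by
  induction hL with
  | empty => simpa using hK
  | union_tile g _ hp hpε hpT hd ih =>
    rw [Set.disjoint_union_right] at h
    rw [← Set.union_assoc]
    exact (ih h.1).union_tile g hp hpε hpT (Set.disjoint_union_left.2 ⟨h.2, hd⟩)

lemma biUnion {ι : Type*} {s : Finset ι} {K : ι → Set G} (hK : ∀ i ∈ s, IsTiled ν T ε (K i))
    (hd : (s : Set ι).PairwiseDisjoint K) : IsTiled ν T ε (⋃ i ∈ s, K i) := by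
  classical
  induction s using Finset.induction_on with
  | empty => simpa using IsTiled.empty
  | insert i s hi ih =>
    rw [Finset.set_biUnion_insert, Set.union_comm]
    refine (ih (fun j hj => hK j (Finset.mem_insert_of_mem hj))
      (hd.subset (by simp))).union (hK i (Finset.mem_insert_self _ _)) ?_
    refine Set.disjoint_iUnion₂_left.2 fun j hj => hd (by simp [hj]) (by simp) ?_
    rintro rfl
    exact hi hj

lemma smul [MeasurableMul G] [ν.IsMulLeftInvariant] {K : Set G}
    (hK : IsTiled ν T ε K) (h : G) : IsTiled ν T ε (h • K) := by
  induction hK with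
  | empty => simpa using IsTiled.empty
  | union_tile g _ hp hpε hpT hd ih =>
    rw [Set.smul_set_union]
    refine ih.union_tile (h * g) (hp.const_smul h) (by rwa [measure_smul]) ?_
      (Set.disjoint_smul_set.2 hd)
    rw [mul_smul]
    exact Set.smul_set_mono hpT

lemma exists_finpartition {K : Set G} (hK : IsTiled ν T ε K) (hε : ε ≠ 0) {U : Set G}
    (hTU : T ⊆ U) : ∃ P : Finpartition K, IsUFine U P ∧ IsEquisize ν P := by
  classical
  suffices h : ∃ P : Finpartition K, IsUFine U P ∧ ∀ p ∈ P.parts, MeasurableSet p ∧ ν p = ε by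
    obtain ⟨P, hP, h⟩ := h
    exact ⟨P, hP, fun p hp => (h p hp).1, fun p hp q hq => (h p hp).2.trans (h q hq).2.symm⟩
  induction hK with
  | empty => exact ⟨Finpartition.empty _, by simp [IsUFine], by simp⟩
  | @union_tile K p g _ hp hpε hpT hd ih =>
    obtain ⟨P, hP, h⟩ := ih
    have hp0 : p ≠ ⊥ := by
      rintro rfl
      exact hε (by simpa using hpε.symm)
    refine ⟨P.extend hp0 hd rfl, ?_, ?_⟩
    · intro q hq
      rcases Finset.mem_insert.1 hq with rfl | hq
      · exact ⟨g, hpT.trans (Set.smul_set_mono hTU)⟩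
      · exact hP q hq
    · intro q hq
      rcases Finset.mem_insert.1 hq with rfl | hq
      · exact ⟨hp, hpε⟩
      · exact h q hq

end IsTiled

/-! ### Core trees -/

/-- Finite subsets of `G` grown from `{1}` one point at a time, each new point `y` lying close to
an older point (`y ∈ x • (V * V)`) and keeping the left translates of the core `W` disjoint. The
order of construction makes such a set a rooted tree of disjoint cores. -/
inductive IsCoreTree {G : Type*} [Group G] (V W : Set G) : Finset G → Prop
  | one : IsCoreTree V W {1}
  | cons {X : Finset G} {x y : G} (hy : y ∉ X) : IsCoreTree V W X → x ∈ X → y ∈ x • (V * V) →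
      (∀ z ∈ X, Disjoint (z • W) (y • W)) → IsCoreTree V W (X.cons y hy)

namespace IsCoreTree

variable {G : Type*} [Group G] {V W : Set G} {X : Finset G}

lemma one_mem (hX : IsCoreTree V W X) : (1 : G) ∈ X := by
  induction hX with
  | one => simp
  | cons _ _ _ _ _ ih => simp [ih]

lemma pairwiseDisjoint (hX : IsCoreTree V W X) :
    (X : Set G).PairwiseDisjoint fun x => x • W := by
  induction hX with
  | one => simp
  | cons _ _ _ _ hd ih =>
    rw [Finset.coe_cons, Set.pairwiseDisjoint_insert]
    exact ⟨ih, fun z hz _ => (hd z hz).symm⟩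

lemma mem_closure (hX : IsCoreTree V W X) : ∀ x ∈ X, x ∈ Subgroup.closure V := by
  induction hX with
  | one => simp
  | @cons X x y _ _ hx hy _ ih =>
    intro z hz
    rcases Finset.mem_cons.1 hz with rfl | hz
    · obtain ⟨_, ⟨a, ha, b, hb, rfl⟩, rfl⟩ := hy
      exact mul_mem (ih x hx) (mul_mem (Subgroup.subset_closure ha) (Subgroup.subset_closure hb))
    · exact ih z hz

variable [TopologicalSpace G] [IsTopologicalGroup G] [MeasurableSpace G] [BorelSpace G]

lemma card_mul_measure_le (ν : Measure G) [ν.IsMulLeftInvariant]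
    (hX : IsCoreTree V W X) (hW : MeasurableSet W) {Q : Set G} (hXQ : (X : Set G) ⊆ Q) :
    X.card * ν W ≤ ν (Q * W) := by
  calc (X.card : ENNReal) * ν W = ∑ x ∈ X, ν (x • W) := by simp [measure_smul]
    _ = ν (⋃ x ∈ X, x • W) :=
      (measure_biUnion_finset hX.pairwiseDisjoint fun x _ => hW.const_smul x).symm
    _ ≤ ν (Q * W) := measure_mono <| Set.iUnion₂_subset fun x hx => by
      rintro _ ⟨w, hw, rfl⟩
      exact Set.mul_mem_mul (hXQ hx) hw

/-- A core tree that is maximal inside the compact set `V ^ n` covers `V ^ n` up to `V`: otherwise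
the first point left uncovered along a chain of steps in `V` could be adjoined. -/
lemma exists_pow_subset_mul [T2Space G] (ν : Measure G) [ν.IsHaarMeasure]
    (hV : IsCompact V) (hV1 : (1 : G) ∈ V) (hW : IsCompact W) (hW1 : W ∈ 𝓝 (1 : G))
    (hWV : W * W⁻¹ ⊆ V) (n : ℕ) : ∃ X : Finset G, IsCoreTree V W X ∧ V ^ n ⊆ X * V := by
  have hVn : IsCompact (V ^ n) := by
    clear hWV
    induction n with
    | zero => simp
    | succ n ih => rw [pow_succ]; exact ih.mul hV
  have hWpos : ν W ≠ 0 := (measure_pos_of_mem_nhds ν hW1).ne'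
  obtain ⟨N, hN⟩ := ENNReal.exists_nat_mul_gt hWpos
    ((hVn.mul hW).measure_lt_top (μ := ν)).ne
  have hbdd : ∀ X : Finset G, IsCoreTree V W X → (X : Set G) ⊆ V ^ n → X.card ≤ N := by
    intro X hX hXV
    by_contra! h
    refine absurd (hX.card_mul_measure_le ν hW.measurableSet hXV)
      (not_le.2 (hN.trans_le ?_))
    gcongr
  obtain ⟨X, ⟨hX, hXV⟩, hmax⟩ : ∃ X : Finset G, (IsCoreTree V W X ∧ (X : Set G) ⊆ V ^ n) ∧
      ∀ Y : Finset G, IsCoreTree V W Y ∧ (Y : Set G) ⊆ V ^ n → Y.card ≤ X.card := by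
    have hne : {X : Finset G | IsCoreTree V W X ∧ (X : Set G) ⊆ V ^ n}.Nonempty :=
      ⟨{1}, IsCoreTree.one, by simpa using Set.one_mem_pow hV1⟩
    have hfin : (Finset.card '' {X : Finset G | IsCoreTree V W X ∧ (X : Set G) ⊆ V ^ n}).Finite :=
      (Set.finite_Iic N).subset (by rintro _ ⟨X, hX, rfl⟩; exact hbdd X hX.1 hX.2)
    obtain ⟨X, hX, h⟩ := Set.exists_max_image _ id hfin (hne.image _)
    obtain ⟨X, hX', rfl⟩ := hX
    exact ⟨X, hX', fun Y hY => h _ ⟨Y, hY, rfl⟩⟩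
  refine ⟨X, hX, ?_⟩
  have key : ∀ y ∈ V ^ n, y ∈ (X : Set G) * V * V → y ∈ (X : Set G) * V := by
    rintro y hyn ⟨_, ⟨x, hx, a, ha, rfl⟩, b, hb, rfl⟩
    set y := x * a * b
    by_contra hy
    have hdis : ∀ z ∈ X, Disjoint (z • W) (y • W) := by
      intro z hz
      refine Set.disjoint_left.2 ?_
      rintro _ ⟨w, hw, rfl⟩ ⟨w', hw', h⟩
      refine hy ⟨z, hz, w * w'⁻¹, hWV ⟨w, hw, w'⁻¹, Set.inv_mem_inv.2 hw', rfl⟩, ?_⟩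
      have h : y * w' = z * w := h
      calc z * (w * w'⁻¹) = y * w' * w'⁻¹ := by rw [h, mul_assoc]
        _ = y := mul_inv_cancel_right y w'
    have hyX : y ∉ X := fun h => hy ⟨y, h, 1, hV1, mul_one y⟩
    have hyx : y ∈ x • (V * V) := ⟨a * b, Set.mul_mem_mul ha hb, (mul_assoc x a b).symm⟩
    have := hmax (X.cons y hyX) ⟨IsCoreTree.cons hyX hX hx hyx hdis, by
      rw [Finset.coe_cons]
      exact Set.insert_subset hyn hXV⟩
    simp at this
  have hk : ∀ k ≤ n, V ^ k ⊆ (X : Set G) * V := by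
    intro k
    induction k with
    | zero =>
      intro _
      simpa using Set.mul_mem_mul (Finset.mem_coe.2 hX.one_mem) hV1
    | succ k ih =>
      intro hkn y hy
      refine key y (Set.pow_subset_pow_right hV1 hkn hy) ?_
      rw [pow_succ] at hy
      exact Set.mul_subset_mul_right (ih (by omega)) hy
  exact hk n le_rfl

end IsCoreTree

/-! ### Tiling along a core tree -/

section Tiling

variable {G : Type*} [Group G] [TopologicalSpace G] [IsTopologicalGroup G]
  [LocallyCompactSpace G] [T2Space G] [MeasurableSpace G] [BorelSpace G]
  {ν : Measure G} [ν.IsHaarMeasure]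

/-- The quotient has to be positive: a nonempty null set is not tiled. -/
lemma isTiled_of_measure_eq_succ_mul (hG : ¬ IsOpen ({1} : Set G)) {T Q : Set G} {ε : ENNReal}
    (hε : ε ≠ ⊤) (hQ : IsCompact Q) {g : G} {q : ℕ} {K : Set G} (hKQ : K ⊆ Q)
    (hK : MeasurableSet K) (hKT : K ⊆ g • T) (hν : ν K = (q + 1 : ℕ) * ε) :
    IsTiled ν T ε K := by
  induction q generalizing K with
  | zero =>
    simpa using (IsTiled.empty (ν := ν) (T := T)).union_tile g hK (by simpa using hν) hKT
      (Set.empty_disjoint _)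
  | succ q ih =>
    have hsucc : ((q + 1 + 1 : ℕ) : ENNReal) * ε = (q + 1 : ℕ) * ε + ε := by
      rw [Nat.cast_succ (q + 1), add_mul, one_mul]
    obtain ⟨S, hSK, hS, hSε⟩ := exists_subset_haar_eq hG hQ hKQ hK (ν := ν) (r := ε)
      (by rw [hν, hsucc]; exact le_add_self)
    have hdiff : ν (K \ S) = (q + 1 : ℕ) * ε := by
      rw [measure_sdiff hSK hS.nullMeasurableSet (by rwa [hSε]), hν, hsucc, hSε,
        ENNReal.add_sub_cancel_right hε]
    have := (ih (Set.sdiff_subset.trans hKQ) (hK.diff hS) (Set.sdiff_subset.trans hKT)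
      hdiff).union_tile g hS hSε (hSK.trans hKT) Set.disjoint_sdiff_left
    rwa [Set.sdiff_union_of_subset hSK] at this

/-- A set `K` containing the cores `x • W` of a core tree and covered by the tiles `x • T` is tiled
by sets of measure `ε`, if `ε` is at most the measure of a core and divides that of `K`. The points
of the tree are removed in reverse order of construction: the part of `K` near the last point `y`
that avoids the other cores is tiled up to a remainder of measure less than `ε`, which can be chosen
inside the core of `y` and so lies in the tile of the parent of `y`. -/
lemma IsCoreTree.isTiled (hG : ¬ IsOpen ({1} : Set G)) {V W T : Set G} {ε : ENNReal}
    (hW : IsCompact W) (hT : IsCompact T) (hV1 : (1 : G) ∈ V) (hVWT : V * V * W ⊆ T)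
    (hε : ε ≠ 0) (hεW : ε ≤ ν W) {X : Finset G} (hX : IsCoreTree V W X) {K : Set G}
    (hK : MeasurableSet K) (hWK : ∀ x ∈ X, x • W ⊆ K) (hKT : K ⊆ ⋃ x ∈ X, x • T) {N : ℕ}
    (hN : ν K = N * ε) : IsTiled ν T ε K := by
  have hε' : ε ≠ ⊤ := (hεW.trans_lt hW.measure_lt_top).ne
  have hWT : W ⊆ T := fun w hw => hVWT <| by
    simpa using Set.mul_mem_mul (Set.mul_mem_mul hV1 hV1) hw
  induction hX generalizing K N with
  | one =>
    have hK1 : K ⊆ (1 : G) • T := by simpa using hKT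
    cases N with
    | zero =>
      have h0 : ν W ≤ 0 := by
        calc ν W ≤ ν K := measure_mono (by simpa using hWK)
          _ = 0 := by simpa using hN
      exact absurd (le_antisymm (hεW.trans h0) bot_le) hε
    | succ N => exact isTiled_of_measure_eq_succ_mul hG hε' (hT.smul (1 : G)) hK1 hK hK1 hN
  | @cons X x y hyX hX hx hy hd ih =>
    have hyT : MeasurableSet (y • T) := (hT.smul y).measurableSet
    have hcores : MeasurableSet (⋃ z ∈ X, z • W) :=
      X.measurableSet_biUnion fun z _ => (hW.smul z).measurableSet
    set M := (K ∩ y • T) \ ⋃ z ∈ X, z • W with hMdef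
    have hM : MeasurableSet M := (hK.inter hyT).diff hcores
    have hMT : M ⊆ y • T := Set.sdiff_subset.trans Set.inter_subset_right
    have hMK : M ⊆ K := Set.sdiff_subset.trans Set.inter_subset_left
    have hyM : y • W ⊆ M := Set.subset_sdiff.2
      ⟨Set.subset_inter (hWK y (by simp)) (Set.smul_set_mono hWT),
        Set.disjoint_iUnion₂_right.2 fun z hz => (hd z hz).symm⟩
    have hMfin : ν M ≠ ⊤ := (measure_lt_top_of_subset hMT (hT.smul y).measure_lt_top.ne).ne
    have hyW : ν (y • W) = ν W := measure_smul ν y W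
    obtain ⟨q, r, hr, hq⟩ := ENNReal.exists_eq_nat_mul_add hMfin hε
    obtain ⟨S, hSW, hS, hSr⟩ := exists_subset_haar_eq hG (hW.smul y) subset_rfl
      (hW.smul y).measurableSet (ν := ν) (r := r) (by rw [hyW]; exact hr.le.trans hεW)
    have hr' : r ≠ ⊤ := (hr.trans_le le_top).ne
    have hMS : ν (M \ S) = q * ε := by
      rw [measure_sdiff (hSW.trans hyM) hS.nullMeasurableSet (by rwa [hSr]), hq, hSr,
        ENNReal.add_sub_cancel_right hr']
    -- The quotient `q` is positive because `M` contains the core of `y`.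
    obtain ⟨q, rfl⟩ : ∃ q', q = q' + 1 := Nat.exists_eq_succ_of_ne_zero <| by
      rintro rfl
      refine absurd (hεW.trans (hyW.symm.le.trans (measure_mono hyM))) (not_le.2 ?_)
      simpa [hq] using hr
    have hleaf : IsTiled ν T ε (M \ S) :=
      isTiled_of_measure_eq_succ_mul hG hε' (hT.smul y) (Set.sdiff_subset.trans hMT)
        (hM.diff hS) (Set.sdiff_subset.trans hMT) hMS
    have hMSK : M \ S ⊆ K := Set.sdiff_subset.trans hMK
    have hrest : IsTiled ν T ε (K \ (M \ S)) := by
      refine ih (N := N - (q + 1)) (hK.diff (hM.diff hS)) ?_ ?_ ?_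
      · intro z hz
        refine Set.subset_sdiff.2 ⟨hWK z (by simp [hz]), ?_⟩
        refine Disjoint.mono_right Set.sdiff_subset ?_
        exact Set.disjoint_sdiff_right.mono_left (Set.subset_biUnion_of_mem (u := (· • W)) hz)
      · rintro k ⟨hkK, hk⟩
        by_cases hkM : k ∈ M
        · have hkS : k ∈ S := by_contra fun h => hk ⟨hkM, h⟩
          obtain ⟨w, hw, rfl⟩ := hSW hkS
          obtain ⟨v, hv, rfl⟩ := hy
          refine Set.mem_biUnion hx ⟨v * w, hVWT (Set.mul_mem_mul hv hw), ?_⟩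
          exact (mul_assoc x v w).symm
        · obtain ⟨z, hz, hkz⟩ := Set.mem_iUnion₂.1 (hKT hkK)
          rcases Finset.mem_cons.1 hz with rfl | hz
          · obtain ⟨z, hz, hkz⟩ := Set.mem_iUnion₂.1 (by_contra fun h => hkM ⟨⟨hkK, hkz⟩, h⟩)
            exact Set.mem_biUnion hz (Set.smul_set_mono hWT hkz)
          · exact Set.mem_biUnion hz hkz
      · rw [measure_sdiff hMSK (hM.diff hS).nullMeasurableSet
          (by rw [hMS]; exact ENNReal.mul_ne_top (by simp) hε'), hN, hMS, ENNReal.natCast_sub,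
          ENNReal.sub_mul fun _ _ => hε']
    have := hrest.union hleaf Set.disjoint_sdiff_left
    rwa [Set.sdiff_union_of_subset hMSK] at this

end Tiling

/-! ### Discrete groups -/

/-- In a discrete group compact sets are finite and the singletons are tiles. -/
lemma IsCompact.isTiled_of_isOpen_singleton_one {G : Type*} [Group G] [TopologicalSpace G]
    [IsTopologicalGroup G] [MeasurableSpace G] [BorelSpace G] (ν : Measure G) [ν.IsHaarMeasure]
    (hG : IsOpen ({1} : Set G)) {B : Set G} (hB : IsCompact B) : IsTiled ν {1} (ν {1}) B := by
  have := discreteTopology_of_isOpen_singleton_one hG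
  have hfin : B.Finite := hB.finite_of_discrete
  clear hB
  induction B, hfin using Set.Finite.induction_on with
  | empty => exact IsTiled.empty
  | @insert b s hb hs ih =>
    have hb1 : ({b} : Set G) = b • {1} := by simp
    rw [← Set.union_singleton]
    exact ih.union_tile b (measurableSet_singleton b)
      (by rw [hb1, measure_smul]) hb1.subset (Set.disjoint_singleton_right.2 hb)

/-! ### Cosets of a compactly generated open subgroup -/

section Cosets

variable {G : Type*} [Group G] [TopologicalSpace G] [IsTopologicalGroup G]

lemma exists_isCompact_symm_mul_subset [LocallyCompactSpace G] {U : Set G} (hU : U ∈ 𝓝 (1 : G)) :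
    ∃ V ∈ 𝓝 (1 : G), IsCompact V ∧ V⁻¹ = V ∧ V * V ⊆ U := by
  obtain ⟨K, hK, hK1⟩ := exists_compact_mem_nhds (1 : G)
  obtain ⟨V, hV1, hVc, hVinv, hV⟩ :=
    exists_closed_nhds_one_inv_eq_mul_subset (Filter.inter_mem hU hK1)
  refine ⟨V, hV1, hK.of_isClosed_subset hVc fun v hv => ?_, hVinv, hV.trans Set.inter_subset_left⟩
  exact (hV ⟨v, hv, 1, mem_of_mem_nhds hV1, mul_one v⟩).2

lemma Subgroup.exists_mem_pow_of_mem_closure {H : Type*} [Group H] {V : Set H} (hV : V⁻¹ = V)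
    {h : H} (hh : h ∈ Subgroup.closure V) : ∃ n : ℕ, h ∈ V ^ n := by
  rw [← Subgroup.mem_toSubmonoid, Subgroup.closure_toSubmonoid, hV, Set.union_self] at hh
  induction hh using Submonoid.closure_induction with
  | mem v hv => exact ⟨1, by simpa using hv⟩
  | one => exact ⟨0, by simp⟩
  | mul a b _ _ ha hb =>
    obtain ⟨m, hm⟩ := ha
    obtain ⟨n, hn⟩ := hb
    exact ⟨m + n, by rw [pow_add]; exact Set.mul_mem_mul hm hn⟩

/-- A compact set meets only finitely many left cosets of the subgroup generated by `V`, and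
stays within boundedly many steps of representatives of these cosets. -/
lemma IsCompact.exists_subset_out_smul_pow {B V : Set G} (hB : IsCompact B) (hV1 : V ∈ 𝓝 (1 : G))
    (hV : V⁻¹ = V) : ∃ (I : Finset (G ⧸ Subgroup.closure V)) (n : ℕ),
      B ⊆ ⋃ i ∈ I, i.out • V ^ n := by
  classical
  obtain ⟨t, -, ht⟩ := hB.elim_nhds_subcover (fun x => x • V)
    fun x _ => by simpa using smul_mem_nhds_smul x hV1
  have hpow : ∀ b : G, ∃ n : ℕ, (QuotientGroup.mk b : G ⧸ Subgroup.closure V).out⁻¹ * b ∈ V ^ n :=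
    fun b => Subgroup.exists_mem_pow_of_mem_closure hV
      (QuotientGroup.eq.1 (QuotientGroup.out_eq' _))
  choose n hn using hpow
  refine ⟨t.image QuotientGroup.mk, t.sup n + 1, fun b hb => ?_⟩
  obtain ⟨x, hx, v, hv, rfl⟩ := Set.mem_iUnion₂.1 (ht hb)
  refine Set.mem_biUnion (Finset.mem_image_of_mem _ hx) 
    ⟨(QuotientGroup.mk x : G ⧸ Subgroup.closure V).out⁻¹ * x * v, ?_, ?_⟩
  · rw [pow_succ]
    exact Set.mul_mem_mul
      (Set.pow_subset_pow_right (mem_of_mem_nhds hV1) (Finset.le_sup hx) (hn x)) hv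
  · simp [mul_assoc]

/-- Distinct left cosets carry disjoint translates of subsets of the subgroup. -/
lemma pairwiseDisjoint_out_smul {H : Type*} [Group H] {L : Subgroup H} {K : Set H}
    (hK : K ⊆ L) (I : Set (H ⧸ L)) : I.PairwiseDisjoint fun i => i.out • K := by
  refine fun i _ j _ hij => Set.disjoint_left.2 ?_
  rintro _ ⟨a, ha, rfl⟩ ⟨b, hb, h⟩
  refine hij ?_
  have h : j.out * b = i.out * a := h
  rw [← QuotientGroup.out_eq' i, ← QuotientGroup.out_eq' j, QuotientGroup.eq]
  have : i.out⁻¹ * j.out = a * b⁻¹ := by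
    rw [inv_mul_eq_iff_eq_mul, ← mul_assoc, ← h, mul_inv_cancel_right]
  rw [this]
  exact mul_mem (hK ha) (inv_mem (hK hb))

end Cosets

/-! ### Equisize partitions -/

/-- `G` is a locally compact unimodular group: it carries a Haar measure `ν` that is both left
invariant (part of `IsHaarMeasure`) and right invariant. -/
theorem theorem5 {G : Type*} [Group G] [TopologicalSpace G] [IsTopologicalGroup G]
    [LocallyCompactSpace G] [T2Space G] [MeasurableSpace G] [BorelSpace G]
    (ν : Measure G) [ν.IsHaarMeasure] [ν.IsMulRightInvariant]
    (U : Set G) (hU : U ∈ 𝓝 (1 : G)) (B : Set G) (hB : IsCompact B) :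
    ∃ C : Set G, IsCompact C ∧ B ⊆ C ∧
      ∃ P : Finpartition C, IsUFine U P ∧ IsEquisize ν P := by
  by_cases hG : IsOpen ({1} : Set G)
  · exact ⟨B, hB, subset_rfl, (hB.isTiled_of_isOpen_singleton_one ν hG).exists_finpartition
      (hG.measure_pos ν (Set.singleton_nonempty 1)).ne' (by simpa using mem_of_mem_nhds hU)⟩
  obtain ⟨U', hU'1, -, -, hU'⟩ := exists_isCompact_symm_mul_subset hU
  obtain ⟨V, hV1, hV, hVinv, hVU'⟩ := exists_isCompact_symm_mul_subset hU'1
  obtain ⟨W, hW1, hW, hWinv, hWV⟩ := exists_isCompact_symm_mul_subset hV1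
  have h1V : (1 : G) ∈ V := mem_of_mem_nhds hV1
  have h1W : (1 : G) ∈ W := mem_of_mem_nhds hW1
  have hWsV : W ⊆ V := (Set.subset_mul_left W h1W).trans hWV
  have hVT : V ⊆ V * V * V := Set.subset_mul_right V ⟨1, h1V, 1, h1V, mul_one 1⟩
  have hTU : V * V * V ⊆ U :=
    (Set.mul_subset_mul hVU' ((Set.subset_mul_left V h1V).trans hVU')).trans hU'
  obtain ⟨I, n, hI⟩ := hB.exists_subset_out_smul_pow hV1 hVinv
  obtain ⟨X, hX, hXn⟩ := IsCoreTree.exists_pow_subset_mul ν hV h1V hW hW1 (by rwa [hWinv]) n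
  set K : Set G := X * V with hKdef
  have hK : IsCompact K := X.finite_toSet.isCompact.mul hV
  have hKL : K ⊆ Subgroup.closure V := by
    rintro _ ⟨x, hx, v, hv, rfl⟩
    exact mul_mem (hX.mem_closure x hx) (Subgroup.subset_closure hv)
  have hWK : ∀ x ∈ X, x • W ⊆ K := by
    rintro x hx _ ⟨w, hw, rfl⟩
    exact Set.mul_mem_mul hx (hWsV hw)
  have hWpos : ν W ≠ 0 := (measure_pos_of_mem_nhds ν hW1).ne'
  have hKpos : ν K ≠ 0 := fun h => hWpos <| measure_mono_null (by simpa using hWK 1 hX.one_mem) h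
  -- The common measure of the tiles is `ν K / N`, with `N` so large that it is at most `ν W`.
  obtain ⟨N, hN⟩ := ENNReal.exists_nat_mul_gt hWpos (hK.measure_lt_top (μ := ν)).ne
  have hN0 : (N : ENNReal) ≠ 0 := by
    rintro h
    simp [h] at hN
  have hε : ν K / N ≠ 0 := ENNReal.div_ne_zero.2 ⟨hKpos, by simp⟩
  have htile : IsTiled ν (V * V * V) (ν K / N) K := by
    refine hX.isTiled hG hW ((hV.mul hV).mul hV) h1V (Set.mul_subset_mul_left hWsV) hε
      (ENNReal.div_le_of_le_mul' hN.le) hK.measurableSet hWK ?_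
      (ENNReal.mul_div_cancel hN0 (by simp)).symm
    rintro _ ⟨x, hx, v, hv, rfl⟩
    exact Set.mem_biUnion hx ⟨v, hVT hv, rfl⟩
  refine ⟨⋃ i ∈ I, i.out • K, I.isCompact_biUnion fun i _ => hK.smul _,
    hI.trans (Set.iUnion₂_mono fun i _ => Set.smul_set_mono hXn), ?_⟩
  exact (IsTiled.biUnion (fun i _ => htile.smul i.out)
    (pairwiseDisjoint_out_smul hKL I)).exists_finpartition hε hTU
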